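/- Let $(X,d,\mu)$ be a complete metric measure space, $\mu$ a Borel measure with $0<\mu(B)<\infty$ for every open ball $B$. All curves are non-constant, compact and rectifiable, and are parametrized by arc length, $\gamma:[0,\ell]\to X$; $\int_{\gamma|_{[s,t]}}\rho\,ds=\int_s^t\rho(\gamma(r))\,dr$. For a family $\Gamma$ of curves, $\operatorname{Mod}_1(\Gamma)=\inf\int_X\rho\,d\mu$ over Borel $\rho:X\to[0,\infty]$ with $\int_\gamma\rho\,ds\ge1$ for all $\gamma\in\Gamma$, and $\operatorname{AM}(\Gamma)=\inf\liminf_i\int_X\rho_i\,d\mu$ over sequences of Borel $\rho_i:X\to[0,\infty]$ with $\liminf_i\int_\gamma\rho_i\,ds\ge1$ for all $\gamma\in\Gamma$. A Borel function $g:X\to[0,\infty]$ is a $1$-weak upper gradient of $v$ if $|v(\gamma(0))-v(\gamma(\ell))|\le\int_\gamma g\,ds$ for all curves $\gamma$ outside a family with $\operatorname{Mod}_1=0$. For $u\in L^1_{\rm loc}(X)$ let $$\|Du\|(X)=\inf\Big\{\liminf_{i\to\infty}\ \inf_{g}\int_X g\,d\mu\ :\ v_i\ \text{locally Lipschitz},\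 v_i\to u\text{ in }L^1_{\rm loc}(X)\Big\},$$ where the inner infimum is over all $1$-weak upper gradients $g$ of $v_i$. Let $\operatorname{BV}(X)$ be the class of $u\in L^1(X)$ with $\|Du\|(X)<\infty$, with norm $\|u\|_{\operatorname{BV}}=\|u\|_{L^1(X)}+\|Du\|(X)$. A sequence $(g_i)$ of non-negative Borel functions in $L^1(X)$ with $\liminf_i\int_Xg_i\,d\mu<\infty$ is a $\operatorname{BV}_{\operatorname{AM}}$-upper bound of $u$ if there is a family $\Gamma$ with $\operatorname{AM}(\Gamma)=0$ such that for every curve $\gamma\notin\Gamma$ there is a set $E\subset[0,\ell]$ of length zero with $$|u(\gamma(t))-u(\gamma(s))|\le\liminf_{i\to\infty}\int_{\gamma|_{[s,t]}}g_i\,ds\qquad\text{for all }s,t\in[0,\ell]\setminus E,\ s<t.$$ Let $\|D_{\operatorname{AM}}u\|(X)$ be the infimum of $\liminf_i\int_Xg_i\,d\mu$ over all $\operatorname{BV}_{\operatorname{AM}}$-upper bounds $(g_i)$ of $u$, and let $\operatorname{BV}_{\operatorname{AM}}(X)$ be the class of $u\in L^1(X)$ having a $\operatorname{BV}_{\operatorname{AM}}$-upper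 bound, with norm $\|u\|_{\operatorname{BV}_{\operatorname{AM}}}=\|u\|_{L^1(X)}+\|D_{\operatorname{AM}}u\|(X)$. Suppose that $\mu$ is doubling, $\mu(2B)\le C_D\,\mu(B)$ for every ball $B$, and that $X$ supports an $\operatorname{AM}$-Poincaré inequality: there are $C_P>0$ and $\lambda\ge1$ such that for every $u\in L^1_{\rm loc}(X)$, every $\operatorname{BV}_{\operatorname{AM}}$-upper bound $(g_i)$ of $u$ and every ball $B$ of radius $r>0$, $$\frac1{\mu(B)}\int_B|u-u_B|\,d\mu\le C_P\,r\,\liminf_{i\to\infty}\frac1{\mu(\lambda B)}\int_{\lambda B}g_i\,d\mu,\qquad u_B=\frac1{\mu(B)}\int_Bu\,d\mu.$$ Then $\operatorname{BV}_{\operatorname{AM}}(X)=\operatorname{BV}(X)$, with comparable norms: there is a constant $C\ge1$, depending only on $C_D$, $C_P$ and $\lambda$, such that for every $u\in L^1(X)$ $$C^{-1}\|Du\|(X)\le\|D_{\operatorname{AM}}u\|(X)\le C\,\|Du\|(X),\qquad C^{-1}\|u\|_{\operatorname{BV}}\le\|u\|_{\operatorname{BV}_{\operatorname{AM}}}\le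 C\,\|u\|_{\operatorname{BV}}.$$ -/

import Mathlib

open MeasureTheory Set Filter Topology
open scoped ENNReal NNReal

noncomputable section

/-- A non-constant compact rectifiable curve in `X`, given by its arc-length parametrization
`[0, length] → X`, `0 < length` (the values of `toFun` outside `[0, length]` play no role).
All path integrals below are taken with respect to arc length, so the curves of the theory are
represented by their arc-length parametrizations. -/
structure RectCurve (X : Type*) [MetricSpace X] where
  length : ℝ
  length_pos : 0 < length
  toFun : ℝ → X
  unitSpeed : HasUnitSpeedOn toFun (Icc 0 length)

namespace RectCurve

variable {X : Type*} [MetricSpace X]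

/-- The path integral `∫_{γ|[s,t]} ρ ds` over the subcurve `γ|[s,t]`. -/
def integralOn (γ : RectCurve X) (s t : ℝ) (ρ : X → ℝ≥0∞) : ℝ≥0∞ :=
  ∫⁻ r in Icc s t, ρ (γ.toFun r)

/-- The path integral `∫_γ ρ ds`. -/
def integral (γ : RectCurve X) (ρ : X → ℝ≥0∞) : ℝ≥0∞ :=
  γ.integralOn 0 γ.length ρ

end RectCurve

section Definitions

variable {X : Type*} [MetricSpace X] [MeasurableSpace X]

/-- The `1`-modulus of a family of curves: the infimum of `∫ ρ dμ` over Borel `ρ : X → [0, ∞]` with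
`∫_γ ρ ds ≥ 1` for all `γ ∈ Γ`. -/
def modOne (μ : Measure X) (Γ : Set (RectCurve X)) : ℝ≥0∞ :=
  ⨅ (ρ : X → ℝ≥0∞) (_ : Measurable ρ) (_ : ∀ γ ∈ Γ, 1 ≤ γ.integral ρ), ∫⁻ x, ρ x ∂μ

/-- The approximate modulus (`AM`-modulus) of a family of curves: the infimum of
`liminf_i ∫ ρ_i dμ` over sequences of Borel `ρ_i : X → [0, ∞]` with
`liminf_i ∫_γ ρ_i ds ≥ 1` for all `γ ∈ Γ`. -/
def modAM (μ : Measure X) (Γ : Set (RectCurve X)) : ℝ≥0∞ :=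
  ⨅ (ρ : ℕ → X → ℝ≥0∞) (_ : ∀ i, Measurable (ρ i))
    (_ : ∀ γ ∈ Γ, 1 ≤ liminf (fun i => γ.integral (ρ i)) atTop),
    liminf (fun i => ∫⁻ x, ρ i x ∂μ) atTop

/-- `g` is a `1`-weak upper gradient of `u`: `g` is a non-negative Borel function and
`|u(γ(a)) - u(γ(b))| ≤ ∫_γ g ds` for `1`-a.e. curve `γ`. -/
def IsWeakUpperGradient (μ : Measure X) (u : X → ℝ) (g : X → ℝ≥0∞) : Prop :=
  Measurable g ∧
    modOne μ {γ : RectCurve X |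
      ¬ ENNReal.ofReal |u (γ.toFun 0) - u (γ.toFun γ.length)| ≤ γ.integral g} = 0

/-- `v_i → u` in `L¹_loc(X)`: convergence in `L¹(B)` for every ball `B`. -/
def TendstoL1Loc (μ : Measure X) (v : ℕ → X → ℝ) (u : X → ℝ) : Prop :=
  ∀ (x : X) (r : ℝ), Tendsto (fun i => ∫⁻ y in Metric.ball x r, ‖v i y - u y‖ₑ ∂μ) atTop (𝓝 0)

/-- Miranda's total variation `‖Du‖(X)`: the infimum, over sequences of locally Lipschitz functions
`v_i → u` in `L¹_loc(X)`, of `liminf_i inf_g ∫ g dμ`, where `g` runs over the `1`-weak upper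
gradients of `v_i`. -/
def totalVar (μ : Measure X) (u : X → ℝ) : ℝ≥0∞ :=
  ⨅ (v : ℕ → X → ℝ) (_ : ∀ i, LocallyLipschitz (v i)) (_ : TendstoL1Loc μ v u),
    liminf (fun i => ⨅ (g : X → ℝ≥0∞) (_ : IsWeakUpperGradient μ (v i) g), ∫⁻ x, g x ∂μ) atTop

/-- `u` is (locally integrable and) of bounded variation. -/
def MemBV (μ : Measure X) (u : X → ℝ) : Prop :=
  LocallyIntegrable u μ ∧ totalVar μ u < ∞

/-- `(g_i)` is a `BV_AM`-upper bound of `u`: the `g_i` are non-negative Borel functions in `L¹(X)`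
with `liminf_i ∫ g_i dμ < ∞`, and outside a family `Γ` of curves with `AM(Γ) = 0`, every curve `γ`
satisfies `|u(γ(t)) - u(γ(s))| ≤ liminf_i ∫_{γ|[s,t]} g_i ds` for all `s < t` outside a subset of
the parameter interval of length zero. -/
def IsBVAMUpperBound (μ : Measure X) (u : X → ℝ) (g : ℕ → X → ℝ≥0∞) : Prop :=
  (∀ i, Measurable (g i)) ∧ (∀ i, ∫⁻ x, g i x ∂μ < ∞) ∧
  liminf (fun i => ∫⁻ x, g i x ∂μ) atTop < ∞ ∧
  ∃ Γ : Set (RectCurve X), modAM μ Γ = 0 ∧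
    ∀ γ : RectCurve X, γ ∉ Γ →
      ∃ E : Set ℝ, volume E = 0 ∧
        ∀ s ∈ Icc 0 γ.length \ E, ∀ t ∈ Icc 0 γ.length \ E, s < t →
          ENNReal.ofReal |u (γ.toFun t) - u (γ.toFun s)| ≤
            liminf (fun i => γ.integralOn s t (g i)) atTop

/-- `u ∈ BV_AM(X)`. -/
def MemBVAM (μ : Measure X) (u : X → ℝ) : Prop :=
  Integrable u μ ∧ ∃ g : ℕ → X → ℝ≥0∞, IsBVAMUpperBound μ u g

/-- `‖D_AM u‖(X)`, the infimum of `liminf_i ∫ g_i dμ` over all `BV_AM`-upper bounds of `u`. -/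
def totalVarAM (μ : Measure X) (u : X → ℝ) : ℝ≥0∞ :=
  ⨅ (g : ℕ → X → ℝ≥0∞) (_ : IsBVAMUpperBound μ u g), liminf (fun i => ∫⁻ x, g i x ∂μ) atTop

/-- The norm `‖u‖_{L¹(X)} + ‖Du‖(X)`. -/
def normBV (μ : Measure X) (u : X → ℝ) : ℝ≥0∞ :=
  (∫⁻ x, ‖u x‖ₑ ∂μ) + totalVar μ u

/-- The norm `‖u‖_{L¹(X)} + ‖D_AM u‖(X)`. -/
def normBVAM (μ : Measure X) (u : X → ℝ) : ℝ≥0∞ :=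
  (∫⁻ x, ‖u x‖ₑ ∂μ) + totalVarAM μ u

/-- `μ` is a doubling measure with constant `CD`: balls have positive and finite measure, and
`μ(2B) ≤ CD μ(B)` for every ball `B`. -/
def IsDoublingWith (μ : Measure X) (CD : ℝ≥0) : Prop :=
  ∀ (x : X) (r : ℝ), 0 < r →
    0 < μ (Metric.ball x r) ∧ μ (Metric.ball x r) < ∞ ∧
      μ (Metric.ball x (2 * r)) ≤ CD * μ (Metric.ball x r)

/-- The `AM`-Poincaré inequality with constants `CP` and `lam`, for balls `B = B(x, r)`:
`⨍_B |u - u_B| dμ ≤ CP rad(B) liminf_i ⨍_{lam B} g_i dμ` for every `BV_AM`-upper bound `(g_i)`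
of `u`. The measurable function `u` is taken to be locally integrable, so that its averages are
defined (in a complete doubling space, locally integrable functions are integrable on balls). -/
def AMPoincareWith (μ : Measure X) (CP : ℝ≥0) (lam : ℝ) : Prop :=
  ∀ (u : X → ℝ) (g : ℕ → X → ℝ≥0∞), LocallyIntegrable u μ → IsBVAMUpperBound μ u g →
    ∀ (x : X) (r : ℝ), 0 < r →
      ⨍⁻ y in Metric.ball x r, ‖u y - ⨍ z in Metric.ball x r, u z ∂μ‖ₑ ∂μ ≤
        CP * ENNReal.ofReal r *
          liminf (fun i => ⨍⁻ y in Metric.ball x (lam * r), g i y ∂μ) atTop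

end Definitions

end

/-! The bound `totalVarAM ≤ totalVar` needs only that `μ` is a Borel measure and `u` is a.e.
measurable. Let locally Lipschitz `v_i → u` nearly realize `‖Du‖(X)`, with weak upper gradients
`g_i`. After passing to a rapidly converging subsequence, one function of finite integral has
infinite line integral along every bad curve: those with a subcurve violating some upper gradient
inequality, and those along which `v_i → u` fails on a set of positive length. Such curves form an
`AM`-null family, and on the others the inequalities for `v_i` pass to the limit, so `(g_i)` is an
upper bound of `u` (`isBVAMUpperBound_of_tendsto`).

The converse uses doubling and the Poincaré inequality. At scale `ε`, replace `u` by a discrete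
convolution over a maximal `ε`-separated set. On a ball of radius `ε` of the cover, its Lipschitz
constant is at most a multiple of `1/ε` times the mean oscillation of `u` on the ball of radius
`4ε`. By Poincaré this oscillation, times the measure of the larger ball, is at most a multiple of
`ε` times the liminf of the `g_i`-masses of a dilated ball. Bounded overlap and Fatou for sums give
a total energy controlled by `liminf ∫ g_i` uniformly in `ε`, and an `L¹` error of order `ε`
(`AMPoincareWith.exists_locallyLipschitz_approx`). Letting `ε → 0` bounds `‖Du‖(X)`. -/

noncomputable section

/-! ### Arc-length curves, subcurves and line integrals -/

namespace RectCurve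

variable {X : Type*} [MetricSpace X]

theorem edist_le (γ : RectCurve X) {s t : ℝ} (hs : s ∈ Icc 0 γ.length) (ht : t ∈ Icc 0 γ.length)
    (hst : s ≤ t) : edist (γ.toFun s) (γ.toFun t) ≤ ENNReal.ofReal (t - s) := by
  have h := γ.unitSpeed hs ht
  rw [NNReal.coe_one, one_mul] at h
  rw [← h]
  exact eVariationOn.edist_le _ ⟨hs, le_rfl, hst⟩ ⟨ht, hst, le_rfl⟩

theorem lipschitzOnWith (γ : RectCurve X) : LipschitzOnWith 1 γ.toFun (Icc 0 γ.length) := by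
  intro s hs t ht
  rw [ENNReal.coe_one, one_mul]
  rcases le_total s t with h | h
  · rw [edist_comm s t, edist_dist t s, Real.dist_eq, abs_of_nonneg (sub_nonneg.2 h)]
    exact γ.edist_le hs ht h
  · rw [edist_comm, edist_dist s t, Real.dist_eq, abs_of_nonneg (sub_nonneg.2 h)]
    exact γ.edist_le ht hs h

theorem continuousOn (γ : RectCurve X) : ContinuousOn γ.toFun (Icc 0 γ.length) :=
  γ.lipschitzOnWith.continuousOn

theorem aemeasurable_comp [MeasurableSpace X] [BorelSpace X] (γ : RectCurve X) {ρ : X → ℝ≥0∞}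
    (hρ : Measurable ρ) {s t : ℝ} (hst : Icc s t ⊆ Icc 0 γ.length) :
    AEMeasurable (fun r => ρ (γ.toFun r)) (volume.restrict (Icc s t)) :=
  hρ.comp_aemeasurable ((γ.continuousOn.mono hst).aemeasurable measurableSet_Icc)

/-- The subcurve `γ|[s,t]`, parametrized by arc length. -/
def subcurve (γ : RectCurve X) (s t : ℝ) (hs : 0 ≤ s) (hst : s < t) (ht : t ≤ γ.length) :
    RectCurve X where
  length := t - s
  length_pos := sub_pos.2 hst
  toFun r := γ.toFun (s + r)
  unitSpeed := by
    intro x hx y hy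
    have h := γ.unitSpeed (x := s + x) ⟨by linarith [hx.1], by linarith [hx.2]⟩
      (y := s + y) ⟨by linarith [hy.1], by linarith [hy.2]⟩
    rw [show s + y - (s + x) = y - x by ring] at h
    rw [← h]
    have hm : MonotoneOn (fun r : ℝ => s + r) (Icc 0 (t - s) ∩ Icc x y) :=
      fun a _ b _ hab => by dsimp only; linarith
    have := eVariationOn.comp_eq_of_monotoneOn γ.toFun _ hm
    refine this.trans (congrArg _ ?_)
    ext z
    constructor
    · rintro ⟨r, ⟨h1, h2⟩, rfl⟩
      exact ⟨⟨by dsimp only; linarith [h1.1], by dsimp only; linarith [h1.2]⟩,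
        by dsimp only; linarith [h2.1], by dsimp only; linarith [h2.2]⟩
    · rintro ⟨h1, h2⟩
      exact ⟨z - s, ⟨⟨by linarith [h2.1, hx.1], by linarith [h2.2, hy.2]⟩,
        by linarith [h2.1], by linarith [h2.2]⟩, by dsimp only; ring⟩

theorem integral_subcurve (γ : RectCurve X) (s t : ℝ) (hs : 0 ≤ s) (hst : s < t)
    (ht : t ≤ γ.length) (ρ : X → ℝ≥0∞) :
    (γ.subcurve s t hs hst ht).integral ρ = γ.integralOn s t ρ := by
  have h := (measurePreserving_add_left (volume : Measure ℝ) s).setLIntegral_comp_preimage_emb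
    (measurableEmbedding_addLeft s) (fun r => ρ (γ.toFun r)) (Icc s t)
  have hp : (fun r : ℝ => s + r) ⁻¹' Icc s t = Icc 0 (t - s) := by
    rw [preimage_const_add_Icc, sub_self]
  rw [hp] at h
  exact h

theorem integralOn_le_integral (γ : RectCurve X) {s t : ℝ} (hs : 0 ≤ s) (ht : t ≤ γ.length)
    (ρ : X → ℝ≥0∞) : γ.integralOn s t ρ ≤ γ.integral ρ :=
  lintegral_mono_set (Icc_subset_Icc hs ht)

theorem integral_tsum [MeasurableSpace X] [BorelSpace X] {ι : Type*} [Countable ι]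
    (γ : RectCurve X) {ρ : ι → X → ℝ≥0∞} (hρ : ∀ i, Measurable (ρ i)) :
    γ.integral (fun x => ∑' i, ρ i x) = ∑' i, γ.integral (ρ i) :=
  lintegral_tsum fun i => γ.aemeasurable_comp (hρ i) subset_rfl

theorem integral_mono (γ : RectCurve X) {ρ σ : X → ℝ≥0∞} (h : ρ ≤ σ) :
    γ.integral ρ ≤ γ.integral σ :=
  lintegral_mono fun _ => h _

end RectCurve

/-! ### Exceptional families and the bound of `totalVarAM` by `totalVar` -/

section Modulus

variable {X : Type*} [MetricSpace X] [MeasurableSpace X] [BorelSpace X] {μ : Measure X}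

/-- Sum admissible functions of summably small integral: each contributes at least 1 along every
curve of the family. -/
theorem exists_integral_eq_top_of_modOne_eq_zero {Γ : Set (RectCurve X)} (h : modOne μ Γ = 0)
    {ε : ℝ≥0∞} (hε : ε ≠ 0) :
    ∃ ρ : X → ℝ≥0∞, Measurable ρ ∧ ∫⁻ x, ρ x ∂μ ≤ ε ∧ ∀ γ ∈ Γ, γ.integral ρ = ∞ := by
  obtain ⟨δ, hδ, hsum⟩ := ENNReal.exists_pos_sum_of_countable' hε ℕ
  have hex : ∀ n, ∃ ρ : X → ℝ≥0∞, Measurable ρ ∧ (∀ γ ∈ Γ, 1 ≤ γ.integral ρ) ∧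
      ∫⁻ x, ρ x ∂μ < δ n := fun n => by
    have := h.trans_lt (hδ n)
    simpa only [modOne, iInf_lt_iff, exists_prop] using this
  choose ρ hm hΓ hlt using hex
  refine ⟨fun x => ∑' n, ρ n x, Measurable.tsum hm, ?_, fun γ hγ => ?_⟩
  · rw [lintegral_tsum fun n => (hm n).aemeasurable]
    exact (ENNReal.tsum_le_tsum fun n => (hlt n).le).trans hsum.le
  · rw [γ.integral_tsum hm]
    refine top_unique ?_
    calc (∞ : ℝ≥0∞) = ∑' _ : ℕ, (1 : ℝ≥0∞) := (ENNReal.tsum_const_eq_top_of_ne_zero one_ne_zero).symm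
      _ ≤ _ := ENNReal.tsum_le_tsum fun n => hΓ n γ hγ

/-- The multiples `ρ / (n + 1)` still have infinite line integral along these curves, while their
integrals over `X` tend to 0. -/
theorem modAM_setOf_integral_eq_top {ρ : X → ℝ≥0∞} (hρ : Measurable ρ)
    (hfin : ∫⁻ x, ρ x ∂μ ≠ ∞) : modAM μ {γ : RectCurve X | γ.integral ρ = ∞} = 0 := by
  refine le_antisymm ?_ zero_le
  have hc : ∀ n : ℕ, ((n : ℝ≥0∞) + 1)⁻¹ ≠ 0 := fun n => by simp
  refine iInf₂_le_of_le (fun n x => ((n : ℝ≥0∞) + 1)⁻¹ * ρ x)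
    (fun n => hρ.const_mul _) (iInf_le_of_le (fun γ hγ => ?_) ?_)
  · have : ∀ n : ℕ, γ.integral (fun x => ((n : ℝ≥0∞) + 1)⁻¹ * ρ x) = ∞ := fun n => by
      have h1 : γ.integral (fun x => ((n : ℝ≥0∞) + 1)⁻¹ * ρ x)
          = ((n : ℝ≥0∞) + 1)⁻¹ * γ.integral ρ :=
        lintegral_const_mul'' _ (γ.aemeasurable_comp hρ subset_rfl)
      rw [h1, show γ.integral ρ = ∞ from hγ, ENNReal.mul_top (hc n)]
    simp [this]
  · have ht : Tendsto (fun n : ℕ => ∫⁻ x, ((n : ℝ≥0∞) + 1)⁻¹ * ρ x ∂μ) atTop (𝓝 0) := by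
      simp_rw [lintegral_const_mul _ hρ]
      rw [← zero_mul (∫⁻ x, ρ x ∂μ)]
      refine ENNReal.Tendsto.mul_const ?_ (Or.inr hfin)
      have := (tendsto_add_atTop_iff_nat 1).2 ENNReal.tendsto_inv_nat_nhds_zero
      simpa using this
    exact ht.liminf_eq.le

/-- Outside a family of zero `AM`-modulus, convergence in `L¹` on balls (summable along the
sequence) gives convergence almost everywhere along curves. -/
theorem exists_integral_ne_top_imp_ae_tendsto {x₀ : X} {v : ℕ → X → ℝ} {u : X → ℝ}
    (hv : ∀ i, Measurable (v i)) (hu : AEMeasurable u μ)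
    (hvu : ∀ k : ℕ, ∫⁻ y in Metric.ball x₀ k, ‖v k y - u y‖ₑ ∂μ ≤ 2⁻¹ ^ k) :
    ∃ ρ : X → ℝ≥0∞, Measurable ρ ∧ ∫⁻ x, ρ x ∂μ ≠ ∞ ∧ ∀ γ : RectCurve X, γ.integral ρ ≠ ∞ →
      ∀ᵐ r ∂volume.restrict (Icc 0 γ.length),
        Tendsto (fun i => v i (γ.toFun r)) atTop (𝓝 (u (γ.toFun r))) := by
  obtain ⟨w, hw, huw⟩ := hu
  set N : Set X := toMeasurable μ {x | u x ≠ w x}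
  have hN : μ N = 0 := by rw [measure_toMeasurable]; exact huw
  have hNm : MeasurableSet N := measurableSet_toMeasurable _ _
  set f : ℕ → X → ℝ≥0∞ := fun k => (Metric.ball x₀ k).indicator fun y => ‖v k y - w y‖ₑ
  have hf : ∀ k, Measurable (f k) := fun k =>
    (((hv k).sub hw).enorm).indicator Metric.isOpen_ball.measurableSet
  have hsum : Measurable fun x => ∑' k, f k x := Measurable.tsum hf
  -- Finiteness of the line integral forces the curve to spend zero length in the null set `N`, off
  -- which `u` equals its Borel representative `w`, and makes the series of errors converge at
  -- almost every parameter.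
  refine ⟨fun x => N.indicator (fun _ => ∞) x + ∑' k, f k x,
    (measurable_const.indicator hNm).add hsum, ?_, fun γ hγ => ?_⟩
  · rw [lintegral_add_right _ hsum, lintegral_indicator hNm, setLIntegral_const, hN, mul_zero,
      zero_add, lintegral_tsum fun k => (hf k).aemeasurable]
    refine ne_top_of_le_ne_top (b := ∑' k : ℕ, (2⁻¹ : ℝ≥0∞) ^ k) ?_
      (ENNReal.tsum_le_tsum fun k => ?_)
    · rw [ENNReal.tsum_geometric, ENNReal.one_sub_inv_two, inv_inv]; simp
    · rw [lintegral_indicator Metric.isOpen_ball.measurableSet]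
      refine le_of_eq_of_le (lintegral_congr_ae ?_) (hvu k)
      filter_upwards [ae_restrict_of_ae huw] with x hx
      rw [hx]
  · have hae := ae_lt_top' (γ.aemeasurable_comp
      ((measurable_const.indicator hNm).add hsum) subset_rfl) hγ
    -- The image of the curve is bounded, so the cut-off to balls in `f k` is eventually invisible
    -- along it.
    have hbdd : ∃ K : ℕ, ∀ r ∈ Icc 0 γ.length, dist (γ.toFun r) x₀ < K := by
      obtain ⟨R, hR⟩ := (isCompact_Icc.image_of_continuousOn γ.continuousOn).isBounded.subset_ball x₀
      obtain ⟨K, hK⟩ := exists_nat_gt R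
      exact ⟨K, fun r hr => (Metric.mem_ball.1 (hR (mem_image_of_mem _ hr))).trans hK⟩
    obtain ⟨K, hK⟩ := hbdd
    filter_upwards [hae, ae_restrict_mem measurableSet_Icc] with r hr hrm
    rw [Pi.add_apply, ENNReal.add_lt_top] at hr
    have hrN : γ.toFun r ∉ N := fun h => by simp [h] at hr
    have huwr : u (γ.toFun r) = w (γ.toFun r) := by
      by_contra h
      exact hrN (subset_toMeasurable _ _ h)
    have h0 := ENNReal.tendsto_atTop_zero_of_tsum_ne_top hr.2.ne
    rw [huwr, tendsto_iff_edist_tendsto_0]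
    refine h0.congr' ?_
    filter_upwards [eventually_ge_atTop K] with k hk
    have : γ.toFun r ∈ Metric.ball x₀ k := (hK r hrm).trans_le (by exact_mod_cast hk)
    simp only [f, indicator_of_mem this, edist_eq_enorm_sub]

/-- Weak upper gradients control only endpoints, but a curve with finite integral of every `ρ i` has
no exceptional subcurve. The inequality therefore holds between any two parameters, and passes to
the limit at those where `v i` converges to `u`. -/
theorem isBVAMUpperBound_of_tendsto {x₀ : X} {v : ℕ → X → ℝ} {u : X → ℝ} {g : ℕ → X → ℝ≥0∞}
    (hv : ∀ i, Measurable (v i)) (hu : AEMeasurable u μ)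
    (hvu : ∀ k : ℕ, ∫⁻ y in Metric.ball x₀ k, ‖v k y - u y‖ₑ ∂μ ≤ 2⁻¹ ^ k)
    (hg : ∀ i, IsWeakUpperGradient μ (v i) (g i)) (hfin : ∀ i, ∫⁻ x, g i x ∂μ < ∞)
    (hlim : liminf (fun i => ∫⁻ x, g i x ∂μ) atTop < ∞) : IsBVAMUpperBound μ u g := by
  obtain ⟨ρ₀, hρ₀, hρ₀fin, hconv⟩ := exists_integral_ne_top_imp_ae_tendsto hv hu hvu
  obtain ⟨δ, hδ, hsum⟩ := ENNReal.exists_pos_sum_of_countable' (one_ne_zero (α := ℝ≥0∞)) ℕ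
  choose ρ hρ hρle hρtop using fun i =>
    exists_integral_eq_top_of_modOne_eq_zero (hg i).2 (hδ i).ne'
  have hm : Measurable fun x => ∑' i, ρ i x := Measurable.tsum hρ
  refine ⟨fun i => (hg i).1, hfin, hlim, {γ | γ.integral (fun x => ρ₀ x + ∑' i, ρ i x) = ∞},
    modAM_setOf_integral_eq_top (hρ₀.add hm) ?_, fun γ hγ => ?_⟩
  · rw [lintegral_add_right _ hm, lintegral_tsum fun k => (hρ k).aemeasurable]
    exact ENNReal.add_ne_top.2 ⟨hρ₀fin, ne_top_of_le_ne_top ENNReal.one_ne_top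
      ((ENNReal.tsum_le_tsum hρle).trans hsum.le)⟩
  · have h0 : γ.integral ρ₀ ≠ ∞ :=
      ne_top_of_le_ne_top hγ (γ.integral_mono fun x => le_self_add)
    have hi : ∀ i, γ.integral (ρ i) ≠ ∞ := fun i =>
      ne_top_of_le_ne_top hγ (γ.integral_mono fun x => (ENNReal.le_tsum i).trans le_add_self)
    have hc := hconv γ h0
    rw [ae_restrict_iff' measurableSet_Icc] at hc
    refine ⟨_, hc, fun s hs t ht hst => ?_⟩
    have hs' := not_not.1 hs.2 hs.1
    have ht' := not_not.1 ht.2 ht.1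
    have hlim := ENNReal.tendsto_ofReal ((ht'.sub hs').abs)
    rw [← hlim.liminf_eq]
    refine liminf_le_liminf (Eventually.of_forall fun i => ?_)
    have hsub : γ.subcurve s t hs.1.1 hst ht.1.2 ∉ {γ : RectCurve X |
        ¬ ENNReal.ofReal |v i (γ.toFun 0) - v i (γ.toFun γ.length)| ≤ γ.integral (g i)} := by
      intro hmem
      have := hρtop i _ hmem
      rw [RectCurve.integral_subcurve] at this
      exact hi i (top_unique (this.ge.trans (γ.integralOn_le_integral hs.1.1 ht.1.2 _)))
    have := not_not.1 hsub
    rw [RectCurve.integral_subcurve] at this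
    simpa [RectCurve.subcurve, abs_sub_comm] using this

theorem totalVarAM_le_totalVar {u : X → ℝ} (hu : AEMeasurable u μ) :
    totalVarAM μ u ≤ totalVar μ u := by
  refine le_iInf₂ fun v hv => le_iInf fun hvu => ?_
  rcases isEmpty_or_nonempty X with hX | ⟨⟨x₀⟩⟩
  -- The empty space offers no base point, but it carries no curves, so the zero sequence is an
  -- upper bound.
  · have h0 : IsBVAMUpperBound μ u fun _ _ => 0 := by
      refine ⟨fun _ => measurable_const, by simp, by simp, univ, ?_, by simp⟩
      refine le_antisymm (iInf₂_le_of_le (fun _ _ => 0) (fun _ => measurable_const)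
        (iInf_le_of_le (fun γ => (hX.false (γ.toFun 0)).elim) (by simp))) zero_le
    exact iInf₂_le_of_le _ h0 (by simp)
  set a : ℕ → ℝ≥0∞ :=
    fun i => ⨅ (g : X → ℝ≥0∞) (_ : IsWeakUpperGradient μ (v i) g), ∫⁻ x, g x ∂μ
  change _ ≤ liminf a atTop
  rcases eq_or_ne (liminf a atTop) ∞ with htop | htop
  · rw [htop]; exact le_top
  -- Indices of nearly minimal energy occur frequently and small `L¹` error on the `k`-th ball
  -- eventually, so one subsequence has both properties.
  have hfreq : ∀ k : ℕ, ∃ᶠ i in atTop, a i < liminf a atTop + ((k : ℝ≥0∞) + 1)⁻¹ ∧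
      ∫⁻ y in Metric.ball x₀ k, ‖v i y - u y‖ₑ ∂μ < 2⁻¹ ^ k := fun k => by
    refine (frequently_lt_of_liminf_lt (by isBoundedDefault) ?_).and_eventually ?_
    · exact ENNReal.lt_add_right htop (by simp)
    · exact (hvu x₀ k).eventually_lt_const (ENNReal.pow_pos (by simp) _)
  obtain ⟨φ, -, hφ⟩ := extraction_forall_of_frequently hfreq
  have hex : ∀ k, ∃ g : X → ℝ≥0∞, IsWeakUpperGradient μ (v (φ k)) g ∧
      ∫⁻ x, g x ∂μ < liminf a atTop + ((k : ℝ≥0∞) + 1)⁻¹ := fun k => by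
    simpa only [a, iInf_lt_iff, exists_prop] using (hφ k).1
  choose g hg hlt using hex
  have hle : liminf (fun k => ∫⁻ x, g k x ∂μ) atTop ≤ liminf a atTop := by
    have ht : Tendsto (fun k : ℕ => liminf a atTop + ((k : ℝ≥0∞) + 1)⁻¹) atTop
        (𝓝 (liminf a atTop + 0)) := by
      refine tendsto_const_nhds.add ?_
      have := (tendsto_add_atTop_iff_nat 1).2 ENNReal.tendsto_inv_nat_nhds_zero
      simpa using this
    rw [add_zero] at ht
    rw [← ht.liminf_eq]
    exact liminf_le_liminf (Eventually.of_forall fun k => (hlt k).le)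
  refine (iInf₂_le g ?_).trans hle
  exact isBVAMUpperBound_of_tendsto (x₀ := x₀) (fun i => (hv (φ i)).continuous.measurable) hu
    (fun k => (hφ k).2.le) hg (fun i => (hlt i).trans_le le_top) (hle.trans_lt htop.lt_top)

end Modulus

/-! ### Upper gradients from local Lipschitz constants -/

section UpperGradient

variable {X : Type*} [MetricSpace X]

/-- Local Lipschitz constants on an open cover give an upper gradient. -/
theorem ofReal_abs_sub_le_integral {ι : Type*} {U : ι → Set X} (hU : ∀ i, IsOpen (U i))
    (hcov : ∀ x, ∃ i, x ∈ U i) {v : X → ℝ} {c : ι → ℝ≥0∞}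
    (hv : ∀ i, ∀ x ∈ U i, ∀ y ∈ U i, edist (v x) (v y) ≤ c i * edist x y)
    {g : X → ℝ≥0∞} (hg : ∀ i, ∀ x ∈ U i, c i ≤ g x) (γ : RectCurve X) :
    ENNReal.ofReal |v (γ.toFun 0) - v (γ.toFun γ.length)| ≤ γ.integral g := by
  have hl := γ.length_pos.le
  have hcont := γ.continuousOn.domRestrict
  -- By compactness the parameter interval is cut into finitely many pieces, each mapped into a
  -- single `U i`; the estimate is summed over them.
  obtain ⟨t, ht0, htm, ⟨m, hm⟩, hti⟩ := exists_monotone_Icc_subset_open_cover_Icc hl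
    (c := fun i => (Icc 0 γ.length).domRestrict γ.toFun ⁻¹' U i) (fun i => (hU i).preimage hcont)
    (fun r _ => mem_iUnion.2 (hcov _))
  have key : ∀ n, edist (v (γ.toFun 0)) (v (γ.toFun (t n))) ≤ γ.integralOn 0 (t n) g := by
    intro n
    induction n with
    | zero => rw [ht0, edist_self]; exact zero_le
    | succ n ih =>
      have hle : (t n : ℝ) ≤ t (n + 1) := htm n.le_succ
      obtain ⟨i, hi⟩ := hti n
      have hmem : ∀ r ∈ Icc (t n : ℝ) (t (n + 1)), γ.toFun r ∈ U i := fun r hr =>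
        hi (a := ⟨r, (t n).2.1.trans hr.1, hr.2.trans (t (n + 1)).2.2⟩) ⟨hr.1, hr.2⟩
      have hstep : edist (v (γ.toFun (t n))) (v (γ.toFun (t (n + 1))))
          ≤ ∫⁻ r in Ioc (t n : ℝ) (t (n + 1)), g (γ.toFun r) := by
        calc edist (v (γ.toFun (t n))) (v (γ.toFun (t (n + 1))))
            ≤ c i * edist (γ.toFun (t n)) (γ.toFun (t (n + 1))) :=
              hv i _ (hmem _ ⟨le_rfl, hle⟩) _ (hmem _ ⟨hle, le_rfl⟩)
          _ ≤ c i * ENNReal.ofReal (t (n + 1) - t n) := by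
              gcongr; exact γ.edist_le (t n).2 (t (n + 1)).2 hle
          _ = ∫⁻ _ in Ioc (t n : ℝ) (t (n + 1)), c i := by
              rw [setLIntegral_const, Real.volume_Ioc]
          _ ≤ _ := setLIntegral_mono' measurableSet_Ioc fun r hr =>
              hg i _ (hmem r (Ioc_subset_Icc_self hr))
      have hsplit : γ.integralOn 0 (t (n + 1)) g = γ.integralOn 0 (t n) g +
          ∫⁻ r in Ioc (t n : ℝ) (t (n + 1)), g (γ.toFun r) := by
        unfold RectCurve.integralOn
        rw [← lintegral_union measurableSet_Ioc, Icc_union_Ioc_eq_Icc (t n).2.1 hle]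
        exact disjoint_left.2 fun r hr hr' => hr'.1.not_ge hr.2
      rw [hsplit]
      exact (edist_triangle _ _ _).trans (add_le_add ih hstep)
  have := key m
  rw [hm m le_rfl, edist_dist, Real.dist_eq] at this
  exact this

theorem isWeakUpperGradient_of_forall [MeasurableSpace X] {μ : Measure X} {v : X → ℝ} {g : X → ℝ≥0∞}
    (hg : Measurable g) (h : ∀ γ : RectCurve X,
      ENNReal.ofReal |v (γ.toFun 0) - v (γ.toFun γ.length)| ≤ γ.integral g) :
    IsWeakUpperGradient μ v g := by
  refine ⟨hg, le_antisymm (iInf₂_le_of_le (fun _ => 0) measurable_const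
    (iInf_le_of_le (fun γ hγ => (hγ (h γ)).elim) (by simp))) zero_le⟩

end UpperGradient

/-! ### Separated nets and bounded overlap -/

section Net

variable {X : Type*} [MetricSpace X]

theorem exists_maximal_separated (X : Type*) [MetricSpace X] {ε : ℝ} (hε : 0 < ε) :
    ∃ A : Set X, A.Pairwise (fun a b => ε ≤ dist a b) ∧ ∀ x, ∃ a ∈ A, dist x a < ε := by
  obtain ⟨A, hA⟩ := zorn_subset {A : Set X | A.Pairwise (fun a b => ε ≤ dist a b)}
    (fun c hc hchain => ⟨⋃₀ c, (pairwise_sUnion hchain.directedOn).2 hc,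
      fun s hs => subset_sUnion_of_mem hs⟩)
  refine ⟨A, hA.prop, fun x => ?_⟩
  by_contra! hx
  have hins : (insert x A).Pairwise (fun a b => ε ≤ dist a b) :=
    hA.prop.insert fun b hb _ => ⟨hx b hb, dist_comm x b ▸ hx b hb⟩
  have := hx x (hA.le_of_ge hins (subset_insert x A) (mem_insert x A))
  rw [dist_self] at this
  exact this.not_gt hε

/-- Bound for the overlap of the balls of radius `K * ε` around `ε`-separated points. -/
def overlapConst (CD : ℝ≥0) (K : ℝ) : ℝ≥0 := CD ^ ⌈4 * K + 2⌉₊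

variable [MeasurableSpace X] {μ : Measure X} {CD : ℝ≥0}

theorem IsDoublingWith.measure_ball_pow_le (h : IsDoublingWith μ CD) (x : X) {r : ℝ} (hr : 0 < r)
    (m : ℕ) : μ (Metric.ball x (2 ^ m * r)) ≤ CD ^ m * μ (Metric.ball x r) := by
  induction m with
  | zero => simp
  | succ m ih =>
    rw [pow_succ', mul_assoc, pow_succ', mul_assoc]
    exact (h x _ (by positivity)).2.2.trans (by gcongr)

theorem IsDoublingWith.measure_ball_le (h : IsDoublingWith μ CD) {x y : X} {r R : ℝ} (hr : 0 < r)
    (m : ℕ) (hm : dist x y + R ≤ 2 ^ m * r) :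
    μ (Metric.ball x R) ≤ CD ^ m * μ (Metric.ball y r) :=
  (measure_mono (Metric.ball_subset_ball' (by linarith))).trans (h.measure_ball_pow_le y hr m)

variable [BorelSpace X]

/-- Volume count: the balls of radius `ε / 2` around the points are disjoint, lie in `B`, and by
doubling each has a fixed fraction of its measure. -/
theorem IsDoublingWith.card_le (h : IsDoublingWith μ CD) {A : Set X} {ε : ℝ} (hε : 0 < ε)
    (hA : A.Pairwise fun a b => ε ≤ dist a b) {K : ℝ} (hK : 0 ≤ K) (x : X) (F : Finset X)
    (hFA : ↑F ⊆ A) (hF : ∀ a ∈ F, dist a x < K * ε) :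
    (F.card : ℝ≥0∞) ≤ overlapConst CD K := by
  set m := ⌈4 * K + 2⌉₊
  -- `B` lies in the ball of radius `(2K + 1)ε` around each point of `F`, hence in the one of radius
  -- `2 ^ m * (ε / 2)`.
  have hm : 4 * K + 2 ≤ 2 ^ m :=
    (Nat.le_ceil _).trans (by exact_mod_cast (Nat.lt_two_pow_self (n := m)).le)
  set B := Metric.ball x ((K + 1) * ε)
  have hB := h x ((K + 1) * ε) (by positivity)
  have hdisj : (F : Set X).PairwiseDisjoint fun a => Metric.ball a (ε / 2) :=
    fun a ha b hb hab => Metric.ball_disjoint_ball (by linarith [hA (hFA ha) (hFA hb) hab])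
  have key : (F.card : ℝ≥0∞) * μ B ≤ overlapConst CD K * μ B := by
    calc (F.card : ℝ≥0∞) * μ B = ∑ a ∈ F, μ B := by rw [Finset.sum_const, nsmul_eq_mul]
      _ ≤ ∑ a ∈ F, (CD : ℝ≥0∞) ^ m * μ (Metric.ball a (ε / 2)) := by
          refine Finset.sum_le_sum fun a ha => h.measure_ball_le (by positivity) m ?_
          have := hF a ha
          rw [dist_comm] at this
          nlinarith
      _ = CD ^ m * μ (⋃ a ∈ F, Metric.ball a (ε / 2)) := by
          rw [← Finset.mul_sum, measure_biUnion_finset hdisj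
            fun a _ => Metric.isOpen_ball.measurableSet]
      _ ≤ CD ^ m * μ B := by
          gcongr
          refine iUnion₂_subset fun a ha => Metric.ball_subset_ball' ?_
          nlinarith [hF a ha]
      _ = _ := by rw [overlapConst, ENNReal.coe_pow]
  exact (ENNReal.mul_le_mul_iff_left hB.1.ne' hB.2.1.ne).1 key

theorem IsDoublingWith.finite_inter (h : IsDoublingWith μ CD) {A : Set X} {ε : ℝ} (hε : 0 < ε)
    (hA : A.Pairwise fun a b => ε ≤ dist a b) {K : ℝ} (hK : 0 ≤ K) (x : X) :
    {a ∈ A | dist a x < K * ε}.Finite := by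
  by_contra hinf
  obtain ⟨n, hn⟩ := exists_nat_gt (overlapConst CD K)
  obtain ⟨F, hF, rfl⟩ := Set.Infinite.exists_subset_card_eq hinf n
  have := h.card_le hε hA hK x F (fun a ha => (hF ha).1) fun a ha => (hF ha).2
  exact (ENNReal.coe_le_coe.1 (by simpa using this)).not_gt hn

theorem IsDoublingWith.countable_of_separated (h : IsDoublingWith μ CD) {A : Set X} {ε : ℝ}
    (hε : 0 < ε) (hA : A.Pairwise fun a b => ε ≤ dist a b) : A.Countable := by
  rcases A.eq_empty_or_nonempty with rfl | ⟨x, -⟩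
  · exact countable_empty
  have : A ⊆ ⋃ n : ℕ, {a ∈ A | dist a x < n * ε} := fun a ha => by
    obtain ⟨n, hn⟩ := exists_nat_gt (dist a x / ε)
    exact mem_iUnion.2 ⟨n, ha, (div_lt_iff₀ hε).1 hn⟩
  exact (countable_iUnion fun n : ℕ => (h.finite_inter hε hA n.cast_nonneg x).countable).mono this

theorem IsDoublingWith.tsum_indicator_le (h : IsDoublingWith μ CD) {A : Set X} {ε : ℝ}
    (hε : 0 < ε) (hA : A.Pairwise fun a b => ε ≤ dist a b) {K : ℝ} (hK : 0 ≤ K) (x : X) :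
    ∑' a : A, (Metric.ball (a : X) (K * ε)).indicator (fun _ => (1 : ℝ≥0∞)) x
      ≤ overlapConst CD K := by
  classical
  rw [ENNReal.tsum_eq_iSup_sum]
  refine iSup_le fun s => ?_
  simp only [indicator_apply, Metric.mem_ball]
  rw [Finset.sum_boole]
  refine le_of_eq_of_le ?_ (h.card_le hε hA hK x
    ((s.filter fun a : A => dist x a < K * ε).map (Function.Embedding.subtype _)) ?_ ?_)
  · rw [Finset.card_map]
  · intro a ha
    obtain ⟨b, -, rfl⟩ := Finset.mem_map.1 ha
    exact b.2
  · intro a ha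
    obtain ⟨b, hb, rfl⟩ := Finset.mem_map.1 ha
    rw [dist_comm]
    exact (Finset.mem_filter.1 hb).2

theorem IsDoublingWith.tsum_setLIntegral_le (h : IsDoublingWith μ CD) {A : Set X} {ε : ℝ}
    (hε : 0 < ε) (hA : A.Pairwise fun a b => ε ≤ dist a b) {K : ℝ} (hK : 0 ≤ K)
    {f : X → ℝ≥0∞} (hf : Measurable f) :
    ∑' a : A, ∫⁻ x in Metric.ball (a : X) (K * ε), f x ∂μ
      ≤ overlapConst CD K * ∫⁻ x, f x ∂μ := by
  have : Countable A := (h.countable_of_separated hε hA).to_subtype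
  simp_rw [← lintegral_indicator Metric.isOpen_ball.measurableSet]
  rw [← lintegral_tsum fun a => (hf.indicator Metric.isOpen_ball.measurableSet).aemeasurable,
    ← lintegral_const_mul _ hf]
  refine lintegral_mono fun x => ?_
  have : ∀ a : A, (Metric.ball (a : X) (K * ε)).indicator f x
      = (Metric.ball (a : X) (K * ε)).indicator (fun _ => (1 : ℝ≥0∞)) x * f x := fun a => by
    by_cases hx : x ∈ Metric.ball (a : X) (K * ε) <;> simp [hx]
  simp_rw [this]
  rw [ENNReal.tsum_mul_right]
  gcongr
  exact h.tsum_indicator_le hε hA hK x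

end Net

/-! ### Fatou for sums, and weighted averages -/

/-- Fatou's lemma for counting measure. It merges the separate liminfs that the Poincaré inequality
gives on each ball into a single one. -/
theorem tsum_liminf_le {ι : Type*} [Countable ι] (f : ℕ → ι → ℝ≥0∞) :
    ∑' a, liminf (fun i => f i a) atTop ≤ liminf (fun i => ∑' a, f i a) atTop := by
  let _ : MeasurableSpace ι := ⊤
  have := lintegral_liminf_le (μ := Measure.count) (u := atTop) (f := f)
    fun i => measurable_from_top
  simpa only [lintegral_count] using this

/-- Weighted averages depend in a Lipschitz way on the weights. -/
theorem abs_weighted_average_sub_le {ι : Type*} {F : Finset ι} {w p q : ι → ℝ} {c δ η : ℝ}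
    (hq : ∀ b ∈ F, 0 ≤ q b) (hp1 : 1 ≤ ∑ b ∈ F, p b)
    (hq1 : 1 ≤ ∑ b ∈ F, q b) (hpq : ∀ b ∈ F, |p b - q b| ≤ η) (hw : ∀ b ∈ F, |w b - c| ≤ δ)
    (hδ : 0 ≤ δ) :
    |(∑ b ∈ F, w b * p b) / (∑ b ∈ F, p b) - (∑ b ∈ F, w b * q b) / ∑ b ∈ F, q b|
      ≤ 2 * F.card * δ * η := by
  set S := ∑ b ∈ F, p b
  set T := ∑ b ∈ F, q b
  set f := ∑ b ∈ F, (w b - c) * p b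
  set g := ∑ b ∈ F, (w b - c) * q b
  have hf : ∑ b ∈ F, w b * p b = f + c * S := by
    simp only [f, S, Finset.mul_sum, ← Finset.sum_add_distrib]
    exact Finset.sum_congr rfl fun b _ => by ring
  have hg : ∑ b ∈ F, w b * q b = g + c * T := by
    simp only [g, T, Finset.mul_sum, ← Finset.sum_add_distrib]
    exact Finset.sum_congr rfl fun b _ => by ring
  have hST : |T - S| ≤ F.card * η := by
    simp only [S, T, ← Finset.sum_sub_distrib]
    refine (Finset.abs_sum_le_sum_abs _ _).trans ?_
    rw [← nsmul_eq_mul]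
    exact Finset.sum_le_card_nsmul _ _ _ fun b hb => by rw [abs_sub_comm]; exact hpq b hb
  have hfg : |f - g| ≤ F.card * (δ * η) := by
    simp only [f, g, ← Finset.sum_sub_distrib]
    refine (Finset.abs_sum_le_sum_abs _ _).trans ?_
    rw [← nsmul_eq_mul]
    refine Finset.sum_le_card_nsmul _ _ _ fun b hb => ?_
    rw [← mul_sub, abs_mul]
    exact mul_le_mul (hw b hb) (hpq b hb) (abs_nonneg _) hδ
  have hgT : |g| ≤ δ * T := by
    refine (Finset.abs_sum_le_sum_abs _ _).trans ?_
    rw [Finset.mul_sum]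
    refine Finset.sum_le_sum fun b hb => ?_
    rw [abs_mul, abs_of_nonneg (hq b hb)]
    exact mul_le_mul_of_nonneg_right (hw b hb) (hq b hb)
  have hS0 : 0 < S := by linarith
  have hT0 : 0 < T := by linarith
  -- The constant `c` cancels. The first term carries the change of the numerators, the second that
  -- of the normalizations.
  have e : (f + c * S) / S - (g + c * T) / T = (f - g) / S + g / T * ((T - S) / S) := by
    field_simp; ring
  rw [hf, hg, e]
  have h1 : |(f - g) / S| ≤ F.card * (δ * η) := by
    rw [abs_div, abs_of_pos hS0]
    exact (div_le_self (abs_nonneg _) hp1).trans hfg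
  have h2 : |(T - S) / S| ≤ F.card * η := by
    rw [abs_div, abs_of_pos hS0]
    exact (div_le_self (abs_nonneg _) hp1).trans hST
  have h3 : |g / T| ≤ δ := by
    rw [abs_div, abs_of_pos hT0]
    exact (div_le_iff₀ hT0).2 hgT
  calc _ ≤ |(f - g) / S| + |g / T| * |(T - S) / S| := by
        rw [← abs_mul]; exact abs_add_le _ _
    _ ≤ F.card * (δ * η) + δ * (F.card * η) := by gcongr
    _ = _ := by ring

theorem abs_weighted_average_sub_const_le {ι : Type*} {F : Finset ι} {w p : ι → ℝ} {c δ : ℝ}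
    (hp : ∀ b ∈ F, 0 ≤ p b) (hp1 : 1 ≤ ∑ b ∈ F, p b) (hw : ∀ b ∈ F, |w b - c| ≤ δ) :
    |(∑ b ∈ F, w b * p b) / (∑ b ∈ F, p b) - c| ≤ δ := by
  have hS0 : 0 < ∑ b ∈ F, p b := by linarith
  have e : (∑ b ∈ F, w b * p b) / (∑ b ∈ F, p b) - c
      = (∑ b ∈ F, (w b - c) * p b) / ∑ b ∈ F, p b := by
    rw [eq_div_iff hS0.ne', sub_mul, div_mul_cancel₀ _ hS0.ne', Finset.mul_sum,
      ← Finset.sum_sub_distrib]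
    exact Finset.sum_congr rfl fun b _ => by ring
  rw [e, abs_div, abs_of_pos hS0, div_le_iff₀ hS0, Finset.mul_sum]
  refine (Finset.abs_sum_le_sum_abs _ _).trans (Finset.sum_le_sum fun b hb => ?_)
  rw [abs_mul, abs_of_nonneg (hp b hb)]
  exact mul_le_mul_of_nonneg_right (hw b hb) (hp b hb)

/-! ### Discrete convolutions -/

section DiscreteConvolution

variable {X : Type*} [MetricSpace X]

/-- A `1/ε`-Lipschitz bump, at least `1` on `B(b, ε)` and vanishing off `B(b, 2ε)`. -/
def bump (ε : ℝ) (b x : X) : ℝ := max (2 - dist x b / ε) 0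

theorem bump_nonneg (ε : ℝ) (b x : X) : 0 ≤ bump ε b x := le_max_right _ _

theorem one_le_bump {ε : ℝ} (hε : 0 < ε) {b x : X} (h : dist x b < ε) : 1 ≤ bump ε b x := by
  have := ((div_lt_one hε).2 h).le
  exact le_max_of_le_left (by linarith)

theorem bump_eq_zero {ε : ℝ} (hε : 0 < ε) {b x : X} (h : 2 * ε ≤ dist x b) : bump ε b x = 0 := by
  have := (le_div_iff₀ hε).2 h
  exact max_eq_right (by linarith)

theorem abs_bump_sub_le {ε : ℝ} (hε : 0 < ε) (b x y : X) :
    |bump ε b x - bump ε b y| ≤ dist x y / ε := by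
  refine (abs_max_sub_max_le_abs _ _ _).trans ?_
  rw [show 2 - dist x b / ε - (2 - dist y b / ε) = (dist y b - dist x b) / ε by ring, abs_div,
    abs_of_pos hε, dist_comm x y]
  gcongr
  exact abs_dist_sub_le _ _ _

/-- The discrete convolution `∑ w_b φ_b`, with `(φ_b)` the partition of unity obtained by
normalizing the bumps centred in `A`. -/
def discConv (A : Set X) (ε : ℝ) (w : X → ℝ) (x : X) : ℝ :=
  (∑' b : A, w b * bump ε (b : X) x) / ∑' b : A, bump ε (b : X) x

theorem discConv_eq_sum {A : Set X} {ε : ℝ} (hε : 0 < ε) (w : X → ℝ) {a x : X} {F : Finset A}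
    (hF : ∀ b : A, dist (b : X) a < 3 * ε → b ∈ F) (hx : dist x a < ε) :
    discConv A ε w x = (∑ b ∈ F, w b * bump ε (b : X) x) / ∑ b ∈ F, bump ε (b : X) x := by
  have h0 : ∀ b : A, b ∉ F → bump ε (b : X) x = 0 := fun b hb => by
    refine bump_eq_zero hε ?_
    by_contra! h
    refine hb (hF b ?_)
    linarith [dist_triangle (b : X) x a, dist_comm (b : X) x]
  rw [discConv, tsum_eq_sum h0, tsum_eq_sum fun b hb => by rw [h0 b hb, mul_zero]]

variable [MeasurableSpace X] [BorelSpace X] {μ : Measure X} {CD : ℝ≥0}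

/-- On `B(a, ε)` only centres within `3ε` of `a` contribute, and their number is bounded by
doubling. By maximality one bump is at least 1 at each point, so normalizing does no harm, and the
bounds for weighted averages apply. -/
theorem IsDoublingWith.discConv_bounds (h : IsDoublingWith μ CD) {A : Set X} {ε : ℝ}
    (hε : 0 < ε) (hA : A.Pairwise fun a b => ε ≤ dist a b) (hmax : ∀ x, ∃ a ∈ A, dist x a < ε)
    {w : X → ℝ} {a : X} {c δ : ℝ} (hδ : 0 ≤ δ) (hw : ∀ b ∈ A, dist b a < 3 * ε → |w b - c| ≤ δ) :
    (∀ x ∈ Metric.ball a ε, |discConv A ε w x - c| ≤ δ) ∧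
      ∀ x ∈ Metric.ball a ε, ∀ y ∈ Metric.ball a ε,
        |discConv A ε w x - discConv A ε w y| ≤ 2 * overlapConst CD 3 * δ * (dist x y / ε) := by
  have hfin : {b : A | dist (b : X) a < 3 * ε}.Finite := by
    refine ((h.finite_inter hε hA (by norm_num : (0 : ℝ) ≤ 3) a).preimage
      Subtype.val_injective.injOn).subset fun b hb => ⟨b.2, hb⟩
  set F := hfin.toFinset
  have hF : ∀ b : A, dist (b : X) a < 3 * ε → b ∈ F := fun b hb => hfin.mem_toFinset.2 hb
  have hwF : ∀ b ∈ F, |w (b : A) - c| ≤ δ := fun b hb => hw b b.2 (hfin.mem_toFinset.1 hb)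
  have h1 : ∀ x ∈ Metric.ball a ε, 1 ≤ ∑ b ∈ F, bump ε (b : X) x := fun x hx => by
    obtain ⟨b, hb, hxb⟩ := hmax x
    refine (one_le_bump hε hxb).trans (Finset.single_le_sum
      (f := fun b : A => bump ε (b : X) x) (fun i _ => bump_nonneg _ _ _) (hF ⟨b, hb⟩ ?_))
    have := Metric.mem_ball.1 hx
    change dist b a < 3 * ε
    linarith [dist_triangle b x a, dist_comm b x]
  have hcard : (F.card : ℝ) ≤ overlapConst CD 3 := by
    have := h.card_le hε hA (by norm_num : (0 : ℝ) ≤ 3) a (F.map (Function.Embedding.subtype _))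
      (fun a ha => by obtain ⟨b, -, rfl⟩ := Finset.mem_map.1 ha; exact b.2)
      (fun a ha => by
        obtain ⟨b, hb, rfl⟩ := Finset.mem_map.1 ha; exact hfin.mem_toFinset.1 hb)
    rw [Finset.card_map] at this
    exact_mod_cast this
  refine ⟨fun x hx => ?_, fun x hx y hy => ?_⟩
  · rw [discConv_eq_sum hε w hF hx]
    exact abs_weighted_average_sub_const_le (fun _ _ => bump_nonneg _ _ _) (h1 x hx) hwF
  · rw [discConv_eq_sum hε w hF hx, discConv_eq_sum hε w hF hy]
    refine (abs_weighted_average_sub_le (fun _ _ => bump_nonneg _ _ _) (h1 x hx) (h1 y hy)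
      (fun b _ => abs_bump_sub_le hε (b : X) x y) hwF hδ).trans ?_
    gcongr

end DiscreteConvolution

/-! ### Averages and mean oscillation -/

section MeanOscillation

variable {X : Type*} [MeasurableSpace X] {μ : Measure X}

theorem enorm_setAverage_sub_le {s : Set X} (h0 : μ s ≠ 0) (htop : μ s ≠ ∞) {u : X → ℝ}
    (hu : IntegrableOn u s μ) (c : ℝ) :
    ‖(⨍ z in s, u z ∂μ) - c‖ₑ ≤ (∫⁻ y in s, ‖u y - c‖ₑ ∂μ) / μ s := by
  have hp : IsProbabilityMeasure ((μ s)⁻¹ • μ.restrict s) :=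
    ⟨by simp [ENNReal.inv_mul_cancel h0 htop]⟩
  have hu' : Integrable u ((μ s)⁻¹ • μ.restrict s) := hu.smul_measure (ENNReal.inv_ne_top.2 h0)
  have e : (⨍ z in s, u z ∂μ) - c = ∫ z, (u z - c) ∂((μ s)⁻¹ • μ.restrict s) := by
    rw [integral_sub hu' (integrable_const c), setAverage_eq', integral_const]
    simp
  rw [e, ← setLAverage_eq, setLAverage_eq']
  exact enorm_integral_le_lintegral_enorm _

/-- The mean oscillation `⨍_s |u - u_s| dμ`. -/
def meanOsc (μ : Measure X) (u : X → ℝ) (s : Set X) : ℝ≥0∞ :=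
  ⨍⁻ y in s, ‖u y - ⨍ z in s, u z ∂μ‖ₑ ∂μ

theorem meanOsc_mul_measure {u : X → ℝ} {s : Set X} (h0 : μ s ≠ 0) (htop : μ s ≠ ∞) :
    meanOsc μ u s * μ s = ∫⁻ y in s, ‖u y - ⨍ z in s, u z ∂μ‖ₑ ∂μ := by
  rw [meanOsc, setLAverage_eq, ENNReal.div_mul_cancel h0 htop]

theorem meanOsc_ne_top {u : X → ℝ} {s : Set X} (h0 : μ s ≠ 0) (htop : μ s ≠ ∞)
    (hu : IntegrableOn u s μ) : meanOsc μ u s ≠ ∞ := by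
  have : IsFiniteMeasure (μ.restrict s) := ⟨by simpa using htop.lt_top⟩
  rw [meanOsc, setLAverage_eq]
  exact ENNReal.div_ne_top (Integrable.sub hu (integrable_const _)).2.ne h0

theorem enorm_setAverage_sub_setAverage_le {s t : Set X} (hst : s ⊆ t) (h0 : μ s ≠ 0)
    (htop : μ t ≠ ∞) {u : X → ℝ} (hu : IntegrableOn u t μ) {K : ℝ≥0∞} (hK : μ t ≤ K * μ s) :
    ‖(⨍ z in s, u z ∂μ) - ⨍ z in t, u z ∂μ‖ₑ ≤ K * meanOsc μ u t := by
  have hs : μ s ≠ ∞ := ne_top_of_le_ne_top htop (measure_mono hst)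
  have ht : μ t ≠ 0 := fun h => h0 (measure_mono_null hst h)
  refine (enorm_setAverage_sub_le h0 hs (hu.mono_set hst) _).trans ?_
  rw [ENNReal.div_le_iff h0 hs]
  calc ∫⁻ y in s, ‖u y - ⨍ z in t, u z ∂μ‖ₑ ∂μ
      ≤ ∫⁻ y in t, ‖u y - ⨍ z in t, u z ∂μ‖ₑ ∂μ := lintegral_mono_set hst
    _ = meanOsc μ u t * μ t := (meanOsc_mul_measure ht htop).symm
    _ ≤ meanOsc μ u t * (K * μ s) := by gcongr
    _ = _ := by ring

end MeanOscillation

/-! ### Poincaré inequality and the bound of `totalVar` by `totalVarAM` -/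

section Poincare

variable {X : Type*} [MetricSpace X] [MeasurableSpace X] {μ : Measure X}
  {CD CP : ℝ≥0} {lam : ℝ}

theorem AMPoincareWith.meanOsc_mul_measure_le (hP : AMPoincareWith μ CP lam)
    (h : IsDoublingWith μ CD) (hlam : 1 ≤ lam) {u : X → ℝ} {g : ℕ → X → ℝ≥0∞}
    (hu : LocallyIntegrable u μ) (hg : IsBVAMUpperBound μ u g) (x : X) {r : ℝ} (hr : 0 < r) :
    meanOsc μ u (Metric.ball x r) * μ (Metric.ball x r) ≤
      CP * ENNReal.ofReal r *
        liminf (fun i => ∫⁻ y in Metric.ball x (lam * r), g i y ∂μ) atTop := by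
  have hm := h x (lam * r) (by positivity)
  calc meanOsc μ u (Metric.ball x r) * μ (Metric.ball x r)
      ≤ (CP * ENNReal.ofReal r *
        liminf (fun i => ⨍⁻ y in Metric.ball x (lam * r), g i y ∂μ) atTop) *
          μ (Metric.ball x (lam * r)) := by
        gcongr
        · exact hP u g hu hg x r hr
        · nlinarith
    _ = _ := by
        rw [mul_assoc, mul_comm (liminf _ _), ← ENNReal.liminf_const_mul_of_ne_top hm.2.1.ne]
        simp_rw [measure_mul_setLAverage _ hm.2.1.ne]

variable [BorelSpace X]

/-- The dilated balls of radius `4 * lam * ε` overlap boundedly, so the local bounds add up to one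
global mass; the factor `ε` from the radius survives. -/
theorem AMPoincareWith.tsum_meanOsc_le (hP : AMPoincareWith μ CP lam)
    (h : IsDoublingWith μ CD) (hlam : 1 ≤ lam) {u : X → ℝ} {g : ℕ → X → ℝ≥0∞}
    (hu : LocallyIntegrable u μ) (hg : IsBVAMUpperBound μ u g) {A : Set X} {ε : ℝ} (hε : 0 < ε)
    (hA : A.Pairwise fun a b => ε ≤ dist a b) :
    ∑' a : A, meanOsc μ u (Metric.ball (a : X) (4 * ε)) * μ (Metric.ball (a : X) (4 * ε)) ≤
      CP * ENNReal.ofReal (4 * ε) * overlapConst CD (lam * 4) *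
        liminf (fun i => ∫⁻ x, g i x ∂μ) atTop := by
  have : Countable A := (h.countable_of_separated hε hA).to_subtype
  refine (ENNReal.tsum_le_tsum fun a : A =>
    hP.meanOsc_mul_measure_le h hlam hu hg a (by positivity : 0 < 4 * ε)).trans ?_
  rw [ENNReal.tsum_mul_left, mul_assoc (_ * _)]
  gcongr
  refine (tsum_liminf_le _).trans ?_
  rw [← ENNReal.liminf_const_mul_of_ne_top ENNReal.coe_ne_top]
  refine liminf_le_liminf (Eventually.of_forall fun i => ?_)
  simp_rw [← mul_assoc]
  exact h.tsum_setLIntegral_le hε hA (by positivity) (hg.1 i)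

/-- Lipschitz approximation of `u` at scale `ε`. -/
theorem AMPoincareWith.exists_locallyLipschitz_approx (hP : AMPoincareWith μ CP lam)
    (h : IsDoublingWith μ CD) (hlam : 1 ≤ lam) {u : X → ℝ} {g : ℕ → X → ℝ≥0∞}
    (hu : Integrable u μ) (hg : IsBVAMUpperBound μ u g) {ε : ℝ} (hε : 0 < ε) :
    ∃ v : X → ℝ, LocallyLipschitz v ∧
      ∫⁻ x, ‖v x - u x‖ₑ ∂μ ≤ (CD ^ 3 + 1) * (CP * ENNReal.ofReal (4 * ε) *
        overlapConst CD (lam * 4) * liminf (fun i => ∫⁻ x, g i x ∂μ) atTop) ∧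
      ∃ G : X → ℝ≥0∞, IsWeakUpperGradient μ v G ∧
        ∫⁻ x, G x ∂μ ≤ 8 * overlapConst CD 3 * CD ^ 3 * CP * overlapConst CD (lam * 4) *
          liminf (fun i => ∫⁻ x, g i x ∂μ) atTop := by
  obtain ⟨A, hA, hmax⟩ := exists_maximal_separated X hε
  have hAc : Countable A := (h.countable_of_separated hε hA).to_subtype
  have h4 : (0 : ℝ) < 4 * ε := by positivity
  set P : A → ℝ≥0∞ := fun a => meanOsc μ u (Metric.ball (a : X) (4 * ε))
  set c : A → ℝ := fun a => ⨍ z in Metric.ball (a : X) (4 * ε), u z ∂μ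
  set w : X → ℝ := fun b => ⨍ z in Metric.ball b ε, u z ∂μ
  set v := discConv A ε w
  have hB : ∀ a : A, 0 < μ (Metric.ball (a : X) (4 * ε)) ∧ μ (Metric.ball (a : X) (4 * ε)) < ∞ :=
    fun a => ⟨(h a _ h4).1, (h a _ h4).2.1⟩
  have hPtop : ∀ a, (CD : ℝ≥0∞) ^ 3 * P a ≠ ∞ := fun a => ENNReal.mul_ne_top (by simp)
    (meanOsc_ne_top (hB a).1.ne' (hB a).2.ne hu.integrableOn)
  have hsub : ∀ a : A, Metric.ball (a : X) ε ⊆ Metric.ball (a : X) (4 * ε) := fun a =>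
    Metric.ball_subset_ball (by linarith)
  -- Here `B(b, ε) ⊆ B(a, 4ε) ⊆ B(b, 8ε)`, so three doublings compare the two measures, whence `CD ^
  -- 3`.
  have hw : ∀ a : A, ∀ b ∈ A, dist b a < 3 * ε → |w b - c a| ≤ ((CD : ℝ≥0∞) ^ 3 * P a).toReal := by
    intro a b _ hba
    rw [← ENNReal.ofReal_le_iff_le_toReal (hPtop a), ← Real.enorm_eq_ofReal_abs]
    refine enorm_setAverage_sub_setAverage_le (Metric.ball_subset_ball' (by linarith))
      (h b ε hε).1.ne' (hB a).2.ne hu.integrableOn (h.measure_ball_le hε 3 ?_)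
    rw [dist_comm] at hba
    linarith
  have hbd := fun a : A => h.discConv_bounds hε hA hmax ENNReal.toReal_nonneg (hw a)
  set L : A → ℝ≥0∞ :=
    fun a => 2 * overlapConst CD 3 * CD ^ 3 * (ENNReal.ofReal ε)⁻¹ * P a with hL
  have hLip : ∀ a : A, ∀ x ∈ Metric.ball (a : X) ε, ∀ y ∈ Metric.ball (a : X) ε,
      edist (v x) (v y) ≤ L a * edist x y := by
    intro a x hx y hy
    rw [edist_dist, Real.dist_eq]
    refine (ENNReal.ofReal_le_ofReal ((hbd a).2 x hx y hy)).trans_eq ?_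
    rw [ENNReal.ofReal_mul (by positivity), ENNReal.ofReal_mul (by positivity),
      ENNReal.ofReal_mul (by positivity), ENNReal.ofReal_toReal (hPtop a),
      ENNReal.ofReal_div_of_pos hε, ENNReal.ofReal_coe_nnreal, edist_dist,
      ENNReal.ofReal_ofNat, hL, ENNReal.div_eq_inv_mul]
    ring
  have hcov : ∀ x, ∃ a : A, x ∈ Metric.ball (a : X) ε := fun x => by
    obtain ⟨a, ha, hxa⟩ := hmax x
    exact ⟨⟨a, ha⟩, hxa⟩
  have hLtop : ∀ a, L a ≠ ∞ := fun a => by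
    have : L a = 2 * overlapConst CD 3 * (ENNReal.ofReal ε)⁻¹ * (CD ^ 3 * P a) := by
      simp only [hL]; ring
    rw [this]
    refine ENNReal.mul_ne_top (ENNReal.mul_ne_top (by finiteness) ?_) (hPtop a)
    exact ENNReal.inv_ne_top.2 (ENNReal.ofReal_pos.2 hε).ne'
  have hQ := hP.tsum_meanOsc_le h hlam hu.locallyIntegrable hg hε hA
  have hGm : Measurable fun x => ∑' a : A, (Metric.ball (a : X) ε).indicator (fun _ => L a) x :=
    Measurable.tsum fun a => measurable_const.indicator Metric.isOpen_ball.measurableSet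
  refine ⟨v, fun x => ?_, ?_, _, isWeakUpperGradient_of_forall hGm fun γ =>
    ofReal_abs_sub_le_integral (fun a : A => Metric.isOpen_ball) hcov hLip (fun a x hx => ?_) γ, ?_⟩
  · obtain ⟨a, ha⟩ := hcov x
    refine ⟨(L a).toNNReal, _, Metric.isOpen_ball.mem_nhds ha, fun x hx y hy => ?_⟩
    rw [ENNReal.coe_toNNReal (hLtop a)]
    exact hLip a x hx y hy
  -- On each ball of the cover both `v` and `u` are compared with the average `c a`, giving the
  -- summands `CD ^ 3` and `1` of the constant.
  · calc ∫⁻ x, ‖v x - u x‖ₑ ∂μ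
        = ∫⁻ x in ⋃ a : A, Metric.ball (a : X) ε, ‖v x - u x‖ₑ ∂μ := by
          rw [eq_univ_of_forall fun x => mem_iUnion.2 (hcov x), Measure.restrict_univ]
      _ ≤ ∑' a : A, ∫⁻ x in Metric.ball (a : X) ε, ‖v x - u x‖ₑ ∂μ := lintegral_iUnion_le _ _
      _ ≤ ∑' a : A, (CD ^ 3 + 1) * (P a * μ (Metric.ball (a : X) (4 * ε))) := by
          refine ENNReal.tsum_le_tsum fun a => ?_
          calc ∫⁻ x in Metric.ball (a : X) ε, ‖v x - u x‖ₑ ∂μ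
              ≤ ∫⁻ x in Metric.ball (a : X) ε, (CD ^ 3 * P a + ‖u x - c a‖ₑ) ∂μ := by
                refine setLIntegral_mono' Metric.isOpen_ball.measurableSet fun x hx => ?_
                have hxa := ENNReal.ofReal_le_of_le_toReal ((hbd a).1 x hx)
                rw [← Real.enorm_eq_ofReal_abs] at hxa
                rw [← sub_sub_sub_cancel_right (v x) (u x) (c a)]
                exact enorm_sub_le.trans (by gcongr)
            _ = CD ^ 3 * P a * μ (Metric.ball (a : X) ε) +
                  ∫⁻ x in Metric.ball (a : X) ε, ‖u x - c a‖ₑ ∂μ := by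
                rw [lintegral_add_left measurable_const, setLIntegral_const]
            _ ≤ CD ^ 3 * P a * μ (Metric.ball (a : X) (4 * ε)) +
                  ∫⁻ x in Metric.ball (a : X) (4 * ε), ‖u x - c a‖ₑ ∂μ :=
                add_le_add (mul_le_mul_right (measure_mono (hsub a)) _)
                  (lintegral_mono_set (hsub a))
            _ = _ := by
                rw [← meanOsc_mul_measure (hB a).1.ne' (hB a).2.ne]
                simp only [P]
                ring
      _ ≤ _ := by
          rw [ENNReal.tsum_mul_left]
          gcongr
  · refine le_trans ?_ (ENNReal.le_tsum a)
    rw [indicator_of_mem hx]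
  · rw [lintegral_tsum fun a => (measurable_const.indicator
      Metric.isOpen_ball.measurableSet).aemeasurable]
    calc ∑' a : A, ∫⁻ x, (Metric.ball (a : X) ε).indicator (fun _ => L a) x ∂μ
        = ∑' a : A, L a * μ (Metric.ball (a : X) ε) :=
          tsum_congr fun a => lintegral_indicator_const Metric.isOpen_ball.measurableSet _
      _ ≤ ∑' a : A, 2 * overlapConst CD 3 * CD ^ 3 * (ENNReal.ofReal ε)⁻¹ *
            (P a * μ (Metric.ball (a : X) (4 * ε))) := by
          refine ENNReal.tsum_le_tsum fun a => ?_
          rw [hL, mul_assoc]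
          gcongr
          linarith
      _ ≤ 2 * overlapConst CD 3 * CD ^ 3 * (ENNReal.ofReal ε)⁻¹ *
            (CP * ENNReal.ofReal (4 * ε) * overlapConst CD (lam * 4) *
              liminf (fun i => ∫⁻ x, g i x ∂μ) atTop) := by
          rw [ENNReal.tsum_mul_left]
          gcongr
      -- The `1/ε` of the Lipschitz constants cancels the `ε` of the Poincaré radius, leaving a
      -- bound free of `ε`; `8` is `2 * 4`.
      _ = 8 * ((ENNReal.ofReal ε)⁻¹ * ENNReal.ofReal ε) * overlapConst CD 3 * CD ^ 3 * CP *
            overlapConst CD (lam * 4) * liminf (fun i => ∫⁻ x, g i x ∂μ) atTop := by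
          rw [ENNReal.ofReal_mul (by norm_num), ENNReal.ofReal_ofNat]
          ring
      _ = _ := by
          rw [ENNReal.inv_mul_cancel (ENNReal.ofReal_pos.2 hε).ne' ENNReal.ofReal_ne_top, mul_one]

theorem AMPoincareWith.totalVar_le (hP : AMPoincareWith μ CP lam) (h : IsDoublingWith μ CD)
    (hlam : 1 ≤ lam) {u : X → ℝ} {g : ℕ → X → ℝ≥0∞} (hu : Integrable u μ)
    (hg : IsBVAMUpperBound μ u g) :
    totalVar μ u ≤ 8 * overlapConst CD 3 * CD ^ 3 * CP * overlapConst CD (lam * 4) *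
      liminf (fun i => ∫⁻ x, g i x ∂μ) atTop := by
  choose v hv hvu G hG hGle using fun n : ℕ =>
    hP.exists_locallyLipschitz_approx h hlam hu hg (Nat.one_div_pos_of_nat (α := ℝ) (n := n))
  have hconv : TendstoL1Loc μ v u := fun x r => by
    refine tendsto_of_tendsto_of_tendsto_of_le_of_le tendsto_const_nhds ?_ (fun _ => zero_le)
      (fun n => (setLIntegral_le_lintegral _ _).trans (hvu n))
    have h0 : Tendsto (fun n : ℕ => ENNReal.ofReal (4 * (1 / ((n : ℝ) + 1)))) atTop (𝓝 0) := by
      have := ENNReal.tendsto_ofReal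
        ((tendsto_one_div_add_atTop_nhds_zero_nat (𝕜 := ℝ)).const_mul 4)
      simpa using this
    have := ENNReal.Tendsto.const_mul (a := ((CD : ℝ≥0∞) ^ 3 + 1) * (CP *
      overlapConst CD (lam * 4) * liminf (fun i => ∫⁻ x, g i x ∂μ) atTop)) h0
      (Or.inr (by have := hg.2.2.1.ne; finiteness))
    rw [mul_zero] at this
    refine this.congr fun n => ?_
    ring
  refine iInf₂_le_of_le v hv (iInf_le_of_le hconv ?_)
  refine (liminf_le_liminf (Eventually.of_forall fun n =>
    (iInf₂_le (G n) (hG n)).trans (hGle n))).trans ?_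
  rw [liminf_const]

theorem AMPoincareWith.totalVar_le_totalVarAM (hP : AMPoincareWith μ CP lam)
    (h : IsDoublingWith μ CD) (hlam : 1 ≤ lam) {u : X → ℝ} (hu : Integrable u μ) {C : ℝ≥0}
    (hC1 : 1 ≤ C)
    (hC : 8 * overlapConst CD 3 * CD ^ 3 * CP * overlapConst CD (lam * 4) ≤ C) :
    totalVar μ u ≤ C * totalVarAM μ u := by
  -- If `u` has no upper bound the infimum is `∞`; a nonzero factor is needed since `0 * ∞ = 0`.
  have hC0 : (C : ℝ≥0∞) ≠ 0 := by
    rw [Ne, ENNReal.coe_eq_zero]; exact (zero_lt_one.trans_le hC1).ne'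
  rw [totalVarAM, ENNReal.mul_iInf_of_ne hC0 ENNReal.coe_ne_top]
  refine le_iInf fun g => ?_
  rw [ENNReal.mul_iInf_of_ne hC0 ENNReal.coe_ne_top]
  refine le_iInf fun hg => (hP.totalVar_le h hlam hu hg).trans ?_
  gcongr
  exact_mod_cast hC

end Poincare

end

/-! ### Equality of the spaces and comparison of the norms -/

theorem proposition3p3 (CD CP : ℝ≥0) (lam : ℝ) (hCP : 0 < CP) (hlam : 1 ≤ lam) :
    ∃ C : ℝ≥0, 1 ≤ C ∧
      ∀ (X : Type*) [MetricSpace X] [CompleteSpace X] [MeasurableSpace X] [BorelSpace X]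
        (μ : Measure X), IsDoublingWith μ CD → AMPoincareWith μ CP lam →
        {u : X → ℝ | MemBVAM μ u} = {u : X → ℝ | Integrable u μ ∧ MemBV μ u} ∧
        ∀ u : X → ℝ, Integrable u μ →
          (totalVarAM μ u ≤ C * totalVar μ u ∧ totalVar μ u ≤ C * totalVarAM μ u) ∧
          (normBVAM μ u ≤ C * normBV μ u ∧ normBV μ u ≤ C * normBVAM μ u) := by
  -- The maximum with 1 absorbs the `L¹` parts of the norms and the direction that holds with
  -- constant 1.
  set C : ℝ≥0 := max 1 (8 * overlapConst CD 3 * CD ^ 3 * CP * overlapConst CD (lam * 4))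
  have hC1 : 1 ≤ C := le_max_left _ _
  have hC1' : (1 : ℝ≥0∞) ≤ C := by exact_mod_cast hC1
  refine ⟨C, hC1, ?_⟩
  intro X _ _ _ _ μ hD hP
  have hle : ∀ u : X → ℝ, Integrable u μ → totalVarAM μ u ≤ totalVar μ u :=
    fun u hu => totalVarAM_le_totalVar hu.1.aemeasurable
  have hge : ∀ u : X → ℝ, Integrable u μ → totalVar μ u ≤ C * totalVarAM μ u :=
    fun u hu => hP.totalVar_le_totalVarAM hD hlam hu hC1 (le_max_right _ _)
  refine ⟨?_, fun u hu => ⟨⟨(hle u hu).trans (le_mul_of_one_le_left' hC1'), hge u hu⟩, ?_, ?_⟩⟩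
  · ext u
    constructor
    · rintro ⟨hu, g, hg⟩
      refine ⟨hu, hu.locallyIntegrable, (hge u hu).trans_lt ?_⟩
      exact ENNReal.mul_lt_top ENNReal.coe_lt_top ((iInf₂_le g hg).trans_lt hg.2.2.1)
    · rintro ⟨hu, -, htv⟩
      have := (hle u hu).trans_lt htv
      simp only [totalVarAM, iInf_lt_iff] at this
      obtain ⟨g, hg, -⟩ := this
      exact ⟨hu, g, hg⟩
  · exact (add_le_add_right (hle u hu) _).trans (le_mul_of_one_le_left' hC1')
  · rw [normBV, normBVAM, mul_add]
    exact add_le_add (le_mul_of_one_le_left' hC1') (hge u hu)
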